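/- Let $M^n$ be a smooth Riemannian manifold with curvature tensor $R$ and let $g\colon M^n\to\mathbb{R}^{n+p}$ be an isometric immersion with normal bundle $T_g^\perp M$ and second fundamental form $\alpha\colon TM\times TM\to T_g^\perp M$. For $x\in M$ let $$\Gamma(x)=\{X\in T_xM:\ R(X,Y)=0\ \ \forall\, Y\in T_xM\},\qquad \Delta_g(x)=\{X\in T_xM:\ \alpha(X,Y)=0\ \ \forall\, Y\in T_xM\}$$ be the nullity of $M$ and the relative nullity of $g$ at $x$, let $\mu(x)=\dim\Gamma(x)$ and $\nu_g(x)=\dim\Delta_g(x)$, let $\beta=\alpha|_{T_xM\times\Gamma(x)}$, and let $$\mathcal{S}(\beta)=\operatorname{span}\{\alpha(X,Z):\ X\in T_xM,\ Z\in\Gamma(x)\}\subseteq T_g^\perp M(x).$$ Then, at every point $x\in M$ with $\nu_g(x)\leq n-p-1$, $$\mu(x)-\nu_g(x)\ \leq\ \dim\mathcal{S}(\beta)\ \leq\ p-1 .$$ -/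

import Mathlib

open scoped Manifold ContDiff

set_option maxSynthPendingDepth 3

noncomputable section

/-! ### Bilinear maps -/

namespace BilinearMap

variable {V U W : Type*} [AddCommGroup V] [Module ℝ V] [AddCommGroup U] [Module ℝ U]
  [AddCommGroup W] [Module ℝ W]

/-- `S(β)`: the span of all the values `β(X, Y)` of a bilinear map `β : V × U → W`. -/
def valueSpan (β : V →ₗ[ℝ] U →ₗ[ℝ] W) : Submodule ℝ W :=
  Submodule.span ℝ {w : W | ∃ (X : V) (Y : U), β X Y = w}

/-- The (left) nullity `{X ∈ V | β(X, Y) = 0 for all Y ∈ U}` of a bilinear map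
`β : V × U → W`. -/
def leftNullity (β : V →ₗ[ℝ] U →ₗ[ℝ] W) : Submodule ℝ V where
  carrier := {X : V | ∀ Y : U, β X Y = 0}
  add_mem' := fun {X X'} hX hX' Y => by
    rw [map_add, LinearMap.add_apply, hX Y, hX' Y, add_zero]
  zero_mem' := fun Y => by simp
  smul_mem' := fun c X hX Y => by
    rw [map_smul, LinearMap.smul_apply, hX Y, smul_zero]

end BilinearMap

/-! ### Levi-Civita connection and curvature of a metric on a normed space

Here `G y` is the metric at the point `y` of the coordinate space `E`, and `D_u` is the derivative
in the direction `u`. -/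

namespace MetricInCoordinates

variable {E : Type*} [NormedAddCommGroup E] [NormedSpace ℝ E]

/-- The trilinear map `(u, v, w) ↦ T(w, u, v)` obtained from `T`. -/
def rotate (T : E →L[ℝ] E →L[ℝ] E →L[ℝ] ℝ) : E →L[ℝ] E →L[ℝ] E →L[ℝ] ℝ :=
  (ContinuousLinearMap.flipₗᵢ ℝ E E ℝ).toContinuousLinearEquiv.toContinuousLinearMap.comp T.flip

/-- Christoffel symbols of the first kind:
`(u, v, w) ↦ (1/2) (D_u G(v, w) + D_v G(u, w) - D_w G(u, v))` at the point `y`. -/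
def christoffelFirst (G : E → E →L[ℝ] E →L[ℝ] ℝ) (y : E) : E →L[ℝ] E →L[ℝ] E →L[ℝ] ℝ :=
  (2⁻¹ : ℝ) • (fderiv ℝ G y + (fderiv ℝ G y).flip - rotate (fderiv ℝ G y))

theorem christoffelFirst_apply (G : E → E →L[ℝ] E →L[ℝ] ℝ) (y u v w : E) :
    christoffelFirst G y u v w =
      (2⁻¹ : ℝ) * (fderiv ℝ G y u v w + fderiv ℝ G y v u w - fderiv ℝ G y w u v) := by
  simp [christoffelFirst, rotate]

/-- Christoffel symbols of the second kind: `christoffel G y u v` is the covariant derivative at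
`y`, in the direction `u`, of the constant vector field `v` for the Levi-Civita connection of `G`.
It is the vector `c` with `G y c w = christoffelFirst G y u v w` for all `w`. -/
def christoffel (G : E → E →L[ℝ] E →L[ℝ] ℝ) (y : E) : E →L[ℝ] E →L[ℝ] E :=
  ContinuousLinearMap.compL ℝ E (E →L[ℝ] ℝ) E (G y).inverse ∘L christoffelFirst G y

theorem christoffel_spec (G : E → E →L[ℝ] E →L[ℝ] ℝ) (y : E) (hG : (G y).IsInvertible)
    (u v w : E) : G y (christoffel G y u v) w = christoffelFirst G y u v w := by
  have h : G y ((G y).inverse (christoffelFirst G y u v)) = christoffelFirst G y u v := by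
    rw [← ContinuousLinearMap.comp_apply, hG.self_comp_inverse]; rfl
  exact congrArg (fun f : E →L[ℝ] ℝ => f w) h

/-- The Riemann curvature `R(u, v)w = ∇_u ∇_v w - ∇_v ∇_u w` at `y`, for constant vector fields
`u, v, w`. -/
def curvature (G : E → E →L[ℝ] E →L[ℝ] ℝ) (y u v w : E) : E :=
  fderiv ℝ (christoffel G) y u v w - fderiv ℝ (christoffel G) y v u w
    + christoffel G y u (christoffel G y v w) - christoffel G y v (christoffel G y u w)

theorem curvature_add (G : E → E →L[ℝ] E →L[ℝ] ℝ) (y u u' v w : E) :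
    curvature G y (u + u') v w = curvature G y u v w + curvature G y u' v w := by
  simp only [curvature, map_add, _root_.add_apply]
  abel

theorem curvature_smul (G : E → E →L[ℝ] E →L[ℝ] ℝ) (y : E) (c : ℝ) (u v w : E) :
    curvature G y (c • u) v w = c • curvature G y u v w := by
  simp only [curvature, map_smul, _root_.smul_apply, smul_sub, smul_add]

theorem curvature_zero (G : E → E →L[ℝ] E →L[ℝ] ℝ) (y v w : E) :
    curvature G y 0 v w = 0 := by
  simp [curvature]

end MetricInCoordinates

/-! ### Riemannian manifolds -/

namespace RiemannianGeometry

open Bundle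

variable {n : ℕ} {M : Type*} [TopologicalSpace M] [ChartedSpace (EuclideanSpace ℝ (Fin n)) M]
  [IsManifold (𝓡 n) ∞ M]

/-- The differential at `x` of the preferred chart `φ` of `M` at `x`. -/
def chartDeriv (n : ℕ) {M : Type*} [TopologicalSpace M]
    [ChartedSpace (EuclideanSpace ℝ (Fin n)) M] (x : M) :
    TangentSpace (𝓡 n) x →L[ℝ] EuclideanSpace ℝ (Fin n) :=
  mfderiv (𝓡 n) 𝓘(ℝ, EuclideanSpace ℝ (Fin n)) (extChartAt (𝓡 n) x) x

/-- The differential at `y` of the inverse of the preferred chart `φ` of `M` at `x`. -/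
def chartSymmDeriv (n : ℕ) {M : Type*} [TopologicalSpace M]
    [ChartedSpace (EuclideanSpace ℝ (Fin n)) M] (x : M) (y : EuclideanSpace ℝ (Fin n)) :
    EuclideanSpace ℝ (Fin n) →L[ℝ] TangentSpace (𝓡 n) ((extChartAt (𝓡 n) x).symm y) :=
  mfderiv 𝓘(ℝ, EuclideanSpace ℝ (Fin n)) (𝓡 n) (extChartAt (𝓡 n) x).symm y

/-- A Riemannian metric `h` read in the preferred chart `φ` of `M` at `x`: the pull-back of `h` by
`φ⁻¹`. -/
def metricInChart
    (h : ContMDiffRiemannianMetric (𝓡 n) ∞ (EuclideanSpace ℝ (Fin n))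
      (fun x : M => TangentSpace (𝓡 n) x)) (x : M) (y : EuclideanSpace ℝ (Fin n)) :
    EuclideanSpace ℝ (Fin n) →L[ℝ] EuclideanSpace ℝ (Fin n) →L[ℝ] ℝ :=
  (ContinuousLinearMap.precomp ℝ (chartSymmDeriv n x y)).comp
    ((h.inner ((extChartAt (𝓡 n) x).symm y)).comp (chartSymmDeriv n x y))

theorem metricInChart_apply
    (h : ContMDiffRiemannianMetric (𝓡 n) ∞ (EuclideanSpace ℝ (Fin n))
      (fun x : M => TangentSpace (𝓡 n) x)) (x : M) (y u v : EuclideanSpace ℝ (Fin n)) :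
    metricInChart h x y u v = h.inner ((extChartAt (𝓡 n) x).symm y)
      (chartSymmDeriv n x y u) (chartSymmDeriv n x y v) := rfl

/-- The curvature tensor `R(X, Y)Z` of the Riemannian manifold `(M, h)` at `x`, computed in the
preferred chart at `x` (it does not depend on the chart, as `R` is a tensor). The result is the
coordinate expression of the tangent vector `R(X, Y)Z`. -/
def curvatureInChart
    (h : ContMDiffRiemannianMetric (𝓡 n) ∞ (EuclideanSpace ℝ (Fin n))
      (fun x : M => TangentSpace (𝓡 n) x)) (x : M) (X Y Z : TangentSpace (𝓡 n) x) :
    EuclideanSpace ℝ (Fin n) :=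
  MetricInCoordinates.curvature (metricInChart h x) (extChartAt (𝓡 n) x x)
    (chartDeriv n x X) (chartDeriv n x Y) (chartDeriv n x Z)

/-- The nullity `Γ(x) = {X ∈ T_x M | R(X, Y) = 0 for all Y ∈ T_x M}` of `(M, h)` at `x`. -/
def nullity
    (h : ContMDiffRiemannianMetric (𝓡 n) ∞ (EuclideanSpace ℝ (Fin n))
      (fun x : M => TangentSpace (𝓡 n) x)) (x : M) : Submodule ℝ (TangentSpace (𝓡 n) x) where
  carrier := {X | ∀ Y Z : TangentSpace (𝓡 n) x, curvatureInChart h x X Y Z = 0}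
  add_mem' := fun {X X'} hX hX' Y Z => by
    have e : curvatureInChart h x (X + X') Y Z
        = curvatureInChart h x X Y Z + curvatureInChart h x X' Y Z := by
      unfold curvatureInChart
      rw [map_add, MetricInCoordinates.curvature_add]
    rw [e, hX Y Z, hX' Y Z, add_zero]
  zero_mem' := fun Y Z => by
    unfold curvatureInChart
    rw [map_zero, MetricInCoordinates.curvature_zero]
  smul_mem' := fun c X hX Y Z => by
    have e : curvatureInChart h x (c • X) Y Z = c • curvatureInChart h x X Y Z := by
      unfold curvatureInChart
      rw [map_smul, MetricInCoordinates.curvature_smul]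
    rw [e, hX Y Z, smul_zero]

/-- The differential `g_* : T_x M → F` of a map `g : M → F`. -/
def differential (n : ℕ) {M : Type*} [TopologicalSpace M]
    [ChartedSpace (EuclideanSpace ℝ (Fin n)) M] {F : Type*} [NormedAddCommGroup F]
    [NormedSpace ℝ F] (g : M → F) (x : M) : TangentSpace (𝓡 n) x →ₗ[ℝ] F :=
  (show TangentSpace (𝓡 n) x →L[ℝ] F from mfderiv (𝓡 n) 𝓘(ℝ, F) g x).toLinearMap

/-- `g : M → F` is an isometric immersion of the Riemannian manifold `(M, h)` into the Euclidean
space `F`: it is smooth and its differentials preserve inner products. -/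
structure IsIsometricImmersion {F : Type*} [NormedAddCommGroup F] [InnerProductSpace ℝ F]
    (h : ContMDiffRiemannianMetric (𝓡 n) ∞ (EuclideanSpace ℝ (Fin n))
      (fun x : M => TangentSpace (𝓡 n) x)) (g : M → F) : Prop where
  contMDiff : ContMDiff (𝓡 n) 𝓘(ℝ, F) ∞ g
  inner_eq : ∀ (x : M) (X Y : TangentSpace (𝓡 n) x),
    inner ℝ (differential n g x X) (differential n g x Y) = h.inner x X Y

/-- The normal space of `g` at `x`: the orthogonal complement of `g_* T_x M`. -/
def normalSpace (n : ℕ) {M : Type*} [TopologicalSpace M]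
    [ChartedSpace (EuclideanSpace ℝ (Fin n)) M] {F : Type*} [NormedAddCommGroup F]
    [InnerProductSpace ℝ F] (g : M → F) (x : M) : Submodule ℝ F :=
  (LinearMap.range (differential n g x))ᗮ

/-- The second fundamental form `α : T_x M × T_x M → T_x^⊥ M` of `g` at `x`: `α(X, Y)` is the
normal component of the derivative, in the direction `X`, of `g_* Y`, where `Y` is extended to the
vector field that is constant in the preferred chart `φ` at `x`; this derivative is the second
derivative of `g ∘ φ⁻¹`, evaluated at the coordinates of `X` and `Y`. -/
def secondFundamentalForm (n : ℕ) {M : Type*} [TopologicalSpace M]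
    [ChartedSpace (EuclideanSpace ℝ (Fin n)) M] {F : Type*} [NormedAddCommGroup F]
    [InnerProductSpace ℝ F] [FiniteDimensional ℝ F] (g : M → F) (x : M) :
    TangentSpace (𝓡 n) x →ₗ[ℝ] TangentSpace (𝓡 n) x →ₗ[ℝ] normalSpace n g x :=
  LinearMap.mk₂ ℝ
    (fun X Y => (normalSpace n g x).orthogonalProjectionOnto
      (fderiv ℝ (fderiv ℝ (g ∘ (extChartAt (𝓡 n) x).symm)) (extChartAt (𝓡 n) x x)
        (chartDeriv n x X) (chartDeriv n x Y)))
    (fun X X' Y => by simp only [map_add, _root_.add_apply])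
    (fun c X Y => by simp only [map_smul, _root_.smul_apply])
    (fun X Y Y' => by simp only [map_add])
    (fun c X Y => by simp only [map_smul])

/-- The relative nullity `Δ_g(x)` of `g` at `x`: the nullity of its second fundamental form. -/
def relativeNullity (n : ℕ) {M : Type*} [TopologicalSpace M]
    [ChartedSpace (EuclideanSpace ℝ (Fin n)) M] {F : Type*} [NormedAddCommGroup F]
    [InnerProductSpace ℝ F] [FiniteDimensional ℝ F] (g : M → F) (x : M) :
    Submodule ℝ (TangentSpace (𝓡 n) x) :=
  BilinearMap.leftNullity (secondFundamentalForm n g x)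

/-- `β = α|_{TM × Γ}` at the point `x`. -/
def restrictedForm {F : Type*} [NormedAddCommGroup F]
    [InnerProductSpace ℝ F] [FiniteDimensional ℝ F]
    (h : ContMDiffRiemannianMetric (𝓡 n) ∞ (EuclideanSpace ℝ (Fin n))
      (fun x : M => TangentSpace (𝓡 n) x)) (g : M → F) (x : M) :
    TangentSpace (𝓡 n) x →ₗ[ℝ] nullity h x →ₗ[ℝ] normalSpace n g x :=
  (secondFundamentalForm n g x).compl₂ (nullity h x).subtype

end RiemannianGeometry

end

/-! For Z in Γ(x) the Gauss equation becomes ⟨α(X,T), α(Y,Z)⟩ = ⟨α(X,Z), α(Y,T)⟩; in particular β is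
flat. The rest is linear algebra in a positive definite inner product space.

If X₀ maximizes the rank of β(X₀,·), then β maps V × ker β(X₀,·) into the image of β(X₀,·)
(`exists_regular`). Flatness makes these values orthogonal to that image, hence zero
(`exists_kernel_eq_nullity_of_flat`). So ker β(X₀,·) lies in Δ_g, and rank-nullity gives μ ≤ ν + dim
S(β).

For the upper bound, suppose S(β) is the whole normal space. The same argument for the flipped form
gives Z₀ in Γ such that β(X,Z₀) = 0 forces β(X,·) = 0. The Gauss identity then makes α(X,Y)
orthogonal to S(β), so X lies in Δ_g. Hence n ≤ ν + p, contrary to ν ≤ n - p - 1. -/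

noncomputable section

/-! ### Flat bilinear maps -/

namespace BilinearMap

open Module Topology

variable {V U W : Type*} [AddCommGroup V] [Module ℝ V] [AddCommGroup U] [Module ℝ U]

/-- A bilinear map has a regular element: the partial map `β X₀` of maximal rank satisfies
`β(V, ker β X₀) ⊆ β(X₀, U)`. -/
theorem exists_regular [NormedAddCommGroup W] [NormedSpace ℝ W] [FiniteDimensional ℝ W]
    (β : V →ₗ[ℝ] U →ₗ[ℝ] W) :
    ∃ X₀ : V, ∀ Z : U, β X₀ Z = 0 → ∀ X : V, β X Z ∈ LinearMap.range (β X₀) := by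
  obtain ⟨X₀, hX₀⟩ : ∃ X₀ : V, ∀ X : V,
      finrank ℝ (LinearMap.range (β X)) ≤ finrank ℝ (LinearMap.range (β X₀)) := by
    have hfin : (Set.range fun X : V => finrank ℝ (LinearMap.range (β X))).Finite :=
      (Set.finite_Iic (finrank ℝ W)).subset (by
        rintro _ ⟨X, rfl⟩
        exact Submodule.finrank_le _)
    obtain ⟨m, ⟨X₀, rfl⟩, hm⟩ := Set.exists_max_image _ id hfin (Set.range_nonempty _)
    exact ⟨X₀, fun X => hm _ ⟨X, rfl⟩⟩
  refine ⟨X₀, fun Z hZ X => ?_⟩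
  by_contra hnot
  set r := finrank ℝ (LinearMap.range (β X₀)) with hr
  let b := finBasis ℝ (LinearMap.range (β X₀))
  choose e he using fun i => (b i).2
  have hli : LinearIndependent ℝ (fun i => β X₀ (e i)) := by
    simp_rw [he]
    exact b.linearIndependent.map' _ (Submodule.ker_subtype _)
  have hspan : Submodule.span ℝ (Set.range fun i => β X₀ (e i)) ≤ LinearMap.range (β X₀) := by
    rw [Submodule.span_le]
    rintro _ ⟨i, rfl⟩
    exact ⟨e i, rfl⟩
  -- Independence is an open condition, so it persists for small t ≠ 0. Since β X₀ Z = 0, β X Z = β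
  -- (X₀ + t • X) (t⁻¹ • Z), so all r + 1 vectors lie in the range of a single partial map, against
  -- maximality of r.
  let γ : ℝ → Fin (r + 1) → W := fun t => Fin.cons (β X Z) (fun i => β (X₀ + t • X) (e i))
  have hγ0 : LinearIndependent ℝ (γ 0) := by
    simp only [γ, zero_smul, add_zero]
    exact linearIndependent_finCons.2 ⟨hli, fun hm => hnot (hspan hm)⟩
  have hγ : Continuous γ := by
    refine continuous_pi fun i => ?_
    refine Fin.cases ?_ (fun i => ?_) i
    · simpa [γ] using continuous_const
    · simp only [γ, Fin.cons_succ, map_add, map_smul, LinearMap.add_apply, LinearMap.smul_apply]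
      fun_prop
  have hopen : ∀ᶠ t in 𝓝 (0 : ℝ), LinearIndependent ℝ (γ t) :=
    hγ.continuousAt.eventually (isOpen_setOfPred_linearIndependent.mem_nhds hγ0)
  obtain ⟨t, ht, ht0⟩ := ((hopen.filter_mono nhdsWithin_le_nhds).and
    (self_mem_nhdsWithin : {(0 : ℝ)}ᶜ ∈ 𝓝[≠] (0 : ℝ))).exists
  have hle : Submodule.span ℝ (Set.range (γ t)) ≤ LinearMap.range (β (X₀ + t • X)) := by
    rw [Submodule.span_le]
    rintro _ ⟨i, rfl⟩
    refine Fin.cases ?_ (fun i => ?_) i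
    · refine ⟨t⁻¹ • Z, ?_⟩
      simp only [γ, map_add, map_smul, LinearMap.add_apply, LinearMap.smul_apply, hZ, zero_add,
        Fin.cons_zero]
      rw [smul_smul, inv_mul_cancel₀ ht0, one_smul]
    · exact ⟨e i, rfl⟩
  have h1 := Submodule.finrank_mono hle
  rw [finrank_span_eq_card ht, Fintype.card_fin] at h1
  have h2 := hX₀ (X₀ + t • X)
  omega

variable [NormedAddCommGroup W] [InnerProductSpace ℝ W]

theorem mem_valueSpan (β : V →ₗ[ℝ] U →ₗ[ℝ] W) (X : V) (Y : U) : β X Y ∈ valueSpan β :=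
  Submodule.subset_span ⟨X, Y, rfl⟩

theorem range_le_valueSpan (β : V →ₗ[ℝ] U →ₗ[ℝ] W) (X : V) :
    LinearMap.range (β X) ≤ valueSpan β := by
  rintro _ ⟨Y, rfl⟩
  exact mem_valueSpan β X Y

variable [FiniteDimensional ℝ W]

/-- A flat bilinear map into a Euclidean space has a partial map whose kernel is the whole right
nullity. -/
theorem exists_kernel_eq_nullity_of_flat (β : V →ₗ[ℝ] U →ₗ[ℝ] W)
    (hβ : ∀ X Y Z T, inner ℝ (β X Z) (β Y T) = inner ℝ (β X T) (β Y Z)) :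
    ∃ X₀ : V, ∀ Z : U, β X₀ Z = 0 → ∀ X : V, β X Z = 0 := by
  obtain ⟨X₀, hX₀⟩ := exists_regular β
  refine ⟨X₀, fun Z hZ X => ?_⟩
  obtain ⟨T, hT⟩ := hX₀ Z hZ X
  have h := hβ X X₀ Z T
  rwa [hZ, inner_zero_right, hT, inner_self_eq_zero] at h

variable [FiniteDimensional ℝ V] {α : V →ₗ[ℝ] V →ₗ[ℝ] W} {N : Submodule ℝ V}

/-- Rank-nullity for the distinguished partial map `β X₀`: its range lies in the value span, and by
symmetry of `α` its kernel lies in the nullity of `α`. -/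
theorem finrank_le_leftNullity_add_valueSpan (hα : ∀ X Y, α X Y = α Y X)
    (hN : ∀ Z ∈ N, ∀ X Y T, inner ℝ (α X T) (α Y Z) = inner ℝ (α X Z) (α Y T)) :
    finrank ℝ N ≤ finrank ℝ (leftNullity α) + finrank ℝ (valueSpan (α.compl₂ N.subtype)) := by
  set β := α.compl₂ N.subtype
  obtain ⟨X₀, hX₀⟩ := exists_kernel_eq_nullity_of_flat β
    (fun X Y Z T => (hN Z Z.2 X Y T).symm)
  have hker : (LinearMap.ker (β X₀)).map N.subtype ≤ leftNullity α := by
    rintro _ ⟨Z, hZ, rfl⟩ Y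
    rw [hα]
    exact hX₀ Z hZ Y
  have h1 := Submodule.finrank_mono hker
  rw [Submodule.finrank_map_subtype_eq] at h1
  have h2 := Submodule.finrank_mono (range_le_valueSpan β X₀)
  have h3 := (β X₀).finrank_range_add_finrank_ker
  omega

/-- Rank-nullity for a partial map of the flipped form. A vector X in its kernel kills N, and the
identity `hN` then makes every α(X,Y) orthogonal to the value span, here everything. -/
theorem finrank_le_leftNullity_add_of_valueSpan_eq_top
    (hN : ∀ Z ∈ N, ∀ X Y T, inner ℝ (α X T) (α Y Z) = inner ℝ (α X Z) (α Y T))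
    (htop : valueSpan (α.compl₂ N.subtype) = ⊤) :
    finrank ℝ V ≤ finrank ℝ (leftNullity α) + finrank ℝ W := by
  set β := α.compl₂ N.subtype
  obtain ⟨Z₀, hZ₀⟩ := exists_kernel_eq_nullity_of_flat β.flip
    (fun Z T X Y => (hN T T.2 X Y Z).trans (real_inner_comm _ _))
  have hker : LinearMap.ker (β.flip Z₀) ≤ leftNullity α := by
    intro X hX Y
    have hperp : ∀ w ∈ valueSpan β, inner ℝ (α X Y) w = 0 := by
      intro w hw
      induction hw using Submodule.span_induction with
      | mem w hw =>
        obtain ⟨T, Z, rfl⟩ := hw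
        have hXZ : α X Z = 0 := hZ₀ X hX Z
        exact (hN Z Z.2 X T Y).trans (by rw [hXZ, inner_zero_left])
      | zero => exact inner_zero_right _
      | add a b _ _ ha hb => rw [inner_add_right, ha, hb, add_zero]
      | smul c a _ ha => rw [inner_smul_right, ha, mul_zero]
    exact inner_self_eq_zero.1 (hperp _ (htop ▸ Submodule.mem_top))
  have h1 := Submodule.finrank_mono hker
  have h2 := Submodule.finrank_le (LinearMap.range (β.flip Z₀))
  have h3 := (β.flip Z₀).finrank_range_add_finrank_ker
  omega

end BilinearMap

/-! ### Gauss equation in coordinates -/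

namespace MetricInCoordinates

open Topology ContinuousLinearMap

variable {E F : Type*} [NormedAddCommGroup E] [NormedSpace ℝ E]
  [NormedAddCommGroup F] [InnerProductSpace ℝ F]

theorem fderiv_fderiv_symm {H : Type*} [NormedAddCommGroup H] [NormedSpace ℝ H] {f : E → H} {y : E}
    (hf : ContDiffAt ℝ ∞ f y) (u v : E) :
    fderiv ℝ (fderiv ℝ f) y u v = fderiv ℝ (fderiv ℝ f) y v u :=
  (hf.isSymmSndFDerivAt (by simpa using WithTop.coe_le_coe.2 (le_top : (2 : ℕ∞) ≤ ⊤))).eq u v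

theorem curvature_congr {G G' : E → E →L[ℝ] E →L[ℝ] ℝ} {y : E} (h : G =ᶠ[𝓝 y] G') (u v w : E) :
    curvature G y u v w = curvature G' y u v w := by
  have hc : christoffel G =ᶠ[𝓝 y] christoffel G' := by
    filter_upwards [h.eventuallyEq_nhds] with z hz
    simp only [christoffel, christoffelFirst, hz.fderiv_eq, hz.eq_of_nhds]
  simp only [curvature, hc.fderiv_eq, hc.eq_of_nhds]

/-- The metric induced on `E` by a map `f : E → F` into a Euclidean space. -/
def inducedMetric (f : E → F) (y : E) : E →L[ℝ] E →L[ℝ] ℝ :=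
  ((compL ℝ E F ℝ).flip (fderiv ℝ f y)).comp ((innerSL ℝ).comp (fderiv ℝ f y))

theorem inducedMetric_apply (f : E → F) (y u v : E) :
    inducedMetric f y u v = inner ℝ (fderiv ℝ f y u) (fderiv ℝ f y v) := rfl

/-- The part of the second derivative of `f` that the Christoffel symbols of `G` leave over. -/
def covariantHessian (G : E → E →L[ℝ] E →L[ℝ] ℝ) (f : E → F) (y u v : E) : F :=
  fderiv ℝ (fderiv ℝ f) y u v - fderiv ℝ f y (christoffel G y u v)

variable {f : E → F} {y : E}

theorem contDiffAt_inducedMetric (hf : ContDiffAt ℝ ∞ f y) :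
    ContDiffAt ℝ ∞ (inducedMetric f) y := by
  have h1 : ContDiffAt ℝ ∞ (fderiv ℝ f) y := hf.fderiv_right (m := ∞) (by simp)
  have h2 : ContDiffAt ℝ ∞ (fun z => (compL ℝ E F ℝ).flip (fderiv ℝ f z)) y :=
    ((compL ℝ E F ℝ).flip).contDiff.contDiffAt.comp y h1
  exact h2.clm_comp (contDiffAt_const.clm_comp h1)

theorem fderiv_inducedMetric_apply (hf : ContDiffAt ℝ ∞ f y) (u v w : E) :
    fderiv ℝ (inducedMetric f) y u v w =
      inner ℝ (fderiv ℝ (fderiv ℝ f) y u v) (fderiv ℝ f y w)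
        + inner ℝ (fderiv ℝ f y v) (fderiv ℝ (fderiv ℝ f) y u w) := by
  have h1 : HasFDerivAt (fderiv ℝ f) (fderiv ℝ (fderiv ℝ f) y) y :=
    ((hf.fderiv_right (m := ∞) (by simp)).differentiableAt (by simp)).hasFDerivAt
  have hG : HasFDerivAt (inducedMetric f) (fderiv ℝ (inducedMetric f) y) y :=
    ((contDiffAt_inducedMetric hf).differentiableAt (by simp)).hasFDerivAt
  have h2 := (hG.clm_apply (hasFDerivAt_const v y)).clm_apply (hasFDerivAt_const w y)
  have h3 := (h1.clm_apply (hasFDerivAt_const v y)).inner ℝ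
    (h1.clm_apply (hasFDerivAt_const w y))
  have h4 := congrArg (fun T => T u) (h2.unique h3)
  simp at h4
  rw [h4, add_comm]

/-- The three metric derivatives expand into six inner products; symmetry of the second derivative
cancels four and makes the other two equal. -/
theorem christoffelFirst_inducedMetric (hf : ContDiffAt ℝ ∞ f y) (u v w : E) :
    christoffelFirst (inducedMetric f) y u v w =
      inner ℝ (fderiv ℝ (fderiv ℝ f) y u v) (fderiv ℝ f y w) := by
  rw [christoffelFirst_apply]
  simp only [fderiv_inducedMetric_apply hf]
  rw [fderiv_fderiv_symm hf v u, fderiv_fderiv_symm hf w u, fderiv_fderiv_symm hf w v,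
    real_inner_comm (fderiv ℝ (fderiv ℝ f) y u w), real_inner_comm (fderiv ℝ (fderiv ℝ f) y v w)]
  ring

theorem inner_christoffel_inducedMetric (hf : ContDiffAt ℝ ∞ f y)
    (hinv : (inducedMetric f y).IsInvertible) (u v w : E) :
    inner ℝ (fderiv ℝ f y (christoffel (inducedMetric f) y u v)) (fderiv ℝ f y w) =
      inner ℝ (fderiv ℝ (fderiv ℝ f) y u v) (fderiv ℝ f y w) := by
  rw [← inducedMetric_apply, christoffel_spec _ _ hinv, christoffelFirst_inducedMetric hf]

variable [FiniteDimensional ℝ E]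

theorem isInvertible_inducedMetric (hinj : Function.Injective (fderiv ℝ f y)) :
    (inducedMetric f y).IsInvertible := by
  have hi : Function.Injective (inducedMetric f y) := by
    refine (injective_iff_map_eq_zero _).2 fun u hu => hinj ?_
    rw [map_zero]
    have := congrArg (fun T => T u) hu
    simpa [inducedMetric_apply] using this
  have hd : Module.finrank ℝ E = Module.finrank ℝ (E →L[ℝ] ℝ) := by
    rw [← LinearMap.toContinuousLinearMap.finrank_eq]
    exact (Subspace.dual_finrank_eq (K := ℝ) (V := E)).symm
  let e := LinearEquiv.ofInjectiveOfFinrankEq (inducedMetric f y).toLinearMap hi hd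
  exact ⟨e.toContinuousLinearEquiv, by ext; rfl⟩

theorem eventually_isInvertible_inducedMetric (hf : ContDiffAt ℝ ∞ f y)
    (hinj : Function.Injective (fderiv ℝ f y)) :
    ∀ᶠ z in 𝓝 y, (inducedMetric f z).IsInvertible := by
  obtain ⟨e, he⟩ := isInvertible_inducedMetric hinj
  have := (contDiffAt_inducedMetric hf).continuousAt.eventually
    (he ▸ ContinuousLinearEquiv.nhds e)
  exact this

theorem inner_covariantHessian_fderiv (hf : ContDiffAt ℝ ∞ f y)
    (hinj : Function.Injective (fderiv ℝ f y)) (u v w : E) :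
    inner ℝ (covariantHessian (inducedMetric f) f y u v) (fderiv ℝ f y w) = 0 := by
  rw [covariantHessian, inner_sub_left,
    inner_christoffel_inducedMetric hf (isInvertible_inducedMetric hinj), sub_self]

theorem differentiableAt_christoffel {G : E → E →L[ℝ] E →L[ℝ] ℝ} (hG : ContDiffAt ℝ ∞ G y)
    (hinv : (G y).IsInvertible) : DifferentiableAt ℝ (christoffel G) y := by
  have h1 : ContDiffAt ℝ ∞ (fderiv ℝ G) y := hG.fderiv_right (m := ∞) (by simp)
  have h2 : ContDiffAt ℝ ∞ (christoffelFirst G) y := by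
    have hflip : ContDiffAt ℝ ∞ (fun z => (fderiv ℝ G z).flip) y :=
      (flipₗᵢ ℝ E E (E →L[ℝ] ℝ)).toContinuousLinearEquiv.contDiff.contDiffAt.comp y h1
    have hrot : ContDiffAt ℝ ∞ (fun z => rotate (fderiv ℝ G z)) y :=
      contDiffAt_const.clm_comp hflip
    exact ((h1.add hflip).sub hrot).const_smul _
  have h3 : ContDiffAt ℝ ∞ (fun z => (G z).inverse) y :=
    hinv.contDiffAt_map_inverse.comp y hG
  have h4 : ContDiffAt ℝ ∞ (christoffel G) y :=
    ((compL ℝ E (E →L[ℝ] ℝ) E).contDiff.contDiffAt.comp y h3).clm_comp h2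
  exact h4.differentiableAt (by simp)

/-- The derivative of the defining equation of the Christoffel symbols. -/
theorem inner_fderiv_christoffel_add (hf' : ∀ᶠ z in 𝓝 y, ContDiffAt ℝ ∞ f z)
    (hinj : Function.Injective (fderiv ℝ f y)) (u v w t : E) :
    inner ℝ (fderiv ℝ f y (fderiv ℝ (christoffel (inducedMetric f)) y u v w
        + christoffel (inducedMetric f) y u (christoffel (inducedMetric f) y v w)))
        (fderiv ℝ f y t) =
      inner ℝ (fderiv ℝ (fderiv ℝ (fderiv ℝ f)) y u v w) (fderiv ℝ f y t)
        + inner ℝ (covariantHessian (inducedMetric f) f y v w)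
          (covariantHessian (inducedMetric f) f y u t) := by
  have hf := hf'.self_of_nhds
  have hinv := isInvertible_inducedMetric hinj
  have hf1 : ContDiffAt ℝ ∞ (fderiv ℝ f) y := hf.fderiv_right (m := ∞) (by simp)
  have hf2 : ContDiffAt ℝ ∞ (fderiv ℝ (fderiv ℝ f)) y := hf1.fderiv_right (m := ∞) (by simp)
  have d1 : HasFDerivAt (fderiv ℝ f) (fderiv ℝ (fderiv ℝ f) y) y :=
    (hf1.differentiableAt (by simp)).hasFDerivAt
  have d2 : HasFDerivAt (fderiv ℝ (fderiv ℝ f)) (fderiv ℝ (fderiv ℝ (fderiv ℝ f)) y) y :=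
    (hf2.differentiableAt (by simp)).hasFDerivAt
  have dΓ : HasFDerivAt (christoffel (inducedMetric f))
      (fderiv ℝ (christoffel (inducedMetric f)) y) y :=
    (differentiableAt_christoffel (contDiffAt_inducedMetric hf) hinv).hasFDerivAt
  have lhs := (d1.clm_apply ((dΓ.clm_apply (hasFDerivAt_const v y)).clm_apply
    (hasFDerivAt_const w y))).inner ℝ (d1.clm_apply (hasFDerivAt_const t y))
  have rhs := ((d2.clm_apply (hasFDerivAt_const v y)).clm_apply
    (hasFDerivAt_const w y)).inner ℝ (d1.clm_apply (hasFDerivAt_const t y))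
  -- The defining equation must hold near `y`, not only at `y`, for its two sides to have equal
  -- derivatives.
  have heq : (fun z => inner ℝ (fderiv ℝ f z (christoffel (inducedMetric f) z v w))
      (fderiv ℝ f z t)) =ᶠ[𝓝 y]
      fun z => inner ℝ (fderiv ℝ (fderiv ℝ f) z v w) (fderiv ℝ f z t) := by
    filter_upwards [hf', eventually_isInvertible_inducedMetric hf hinj] with z hz hi
    exact inner_christoffel_inducedMetric hz hi v w t
  have key := congrArg (fun T => T u) ((lhs.congr_of_eventuallyEq heq.symm).unique rhs)
  simp [inner_add_left] at key
  -- `n1` allows the second derivative at (u, t) to be replaced by the covariant Hessian; `n2` turns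
  -- the second derivative at (u, Γ(v,w)) into the quadratic Christoffel term.
  have n1 := inner_covariantHessian_fderiv hf hinj v w (christoffel (inducedMetric f) y u t)
  have n2 := inner_christoffel_inducedMetric hf hinv u (christoffel (inducedMetric f) y v w) t
  simp only [covariantHessian, inner_sub_left, inner_sub_right, map_add, inner_add_left] at *
  linarith

/-- The Gauss equation in coordinates. -/
theorem gauss_equation (hf' : ∀ᶠ z in 𝓝 y, ContDiffAt ℝ ∞ f z)
    (hinj : Function.Injective (fderiv ℝ f y)) (u v w t : E) :
    inner ℝ (fderiv ℝ f y (curvature (inducedMetric f) y u v w)) (fderiv ℝ f y t) =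
      inner ℝ (covariantHessian (inducedMetric f) f y v w)
          (covariantHessian (inducedMetric f) f y u t)
        - inner ℝ (covariantHessian (inducedMetric f) f y u w)
          (covariantHessian (inducedMetric f) f y v t) := by
  have h1 := inner_fderiv_christoffel_add hf' hinj u v w t
  have h2 := inner_fderiv_christoffel_add hf' hinj v u w t
  have hf1 : ContDiffAt ℝ ∞ (fderiv ℝ f) y :=
    hf'.self_of_nhds.fderiv_right (m := ∞) (by simp)
  -- The third-derivative terms now agree and cancel on antisymmetrizing in u and v.
  rw [fderiv_fderiv_symm hf1 v u] at h2
  simp only [curvature, map_add, map_sub, inner_add_left, inner_sub_left] at *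
  linarith

end MetricInCoordinates

/-! ### Gauss equation on the manifold -/

namespace RiemannianGeometry

open Bundle Topology MetricInCoordinates

variable {n : ℕ} {M : Type*} [TopologicalSpace M] [ChartedSpace (EuclideanSpace ℝ (Fin n)) M]
  [IsManifold (𝓡 n) ∞ M] {F : Type*} [NormedAddCommGroup F] [InnerProductSpace ℝ F]
  {h : ContMDiffRiemannianMetric (𝓡 n) ∞ (EuclideanSpace ℝ (Fin n))
    (fun x : M => TangentSpace (𝓡 n) x)} {g : M → F}

/-- The map `g` read in the preferred chart at `x`. -/
def inChart (n : ℕ) {M : Type*} [TopologicalSpace M] [ChartedSpace (EuclideanSpace ℝ (Fin n)) M]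
    {F : Type*} (g : M → F) (x : M) : EuclideanSpace ℝ (Fin n) → F :=
  g ∘ (extChartAt (𝓡 n) x).symm

theorem contDiffAt_inChart (hg : ContMDiff (𝓡 n) 𝓘(ℝ, F) ∞ g) {x : M}
    {y : EuclideanSpace ℝ (Fin n)} (hy : y ∈ (extChartAt (𝓡 n) x).target) :
    ContDiffAt ℝ ∞ (inChart n g x) y := by
  rw [← contMDiffAt_iff_contDiffAt]
  exact hg.contMDiffAt.comp y ((contMDiffOn_extChartAt_symm (I := 𝓡 n) (n := ∞) x).contMDiffAt
    ((isOpen_extChartAt_target x).mem_nhds hy))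

theorem fderiv_inChart_apply (hg : ContMDiff (𝓡 n) 𝓘(ℝ, F) ∞ g) {x : M}
    {y : EuclideanSpace ℝ (Fin n)} (hy : y ∈ (extChartAt (𝓡 n) x).target)
    (u : EuclideanSpace ℝ (Fin n)) :
    fderiv ℝ (inChart n g x) y u =
      differential n g ((extChartAt (𝓡 n) x).symm y) (chartSymmDeriv n x y u) := by
  have h1 : MDifferentiableAt 𝓘(ℝ, EuclideanSpace ℝ (Fin n)) (𝓡 n) (extChartAt (𝓡 n) x).symm y :=
    ((contMDiffOn_extChartAt_symm (I := 𝓡 n) (n := ∞) x).contMDiffAt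
      ((isOpen_extChartAt_target x).mem_nhds hy)).mdifferentiableAt (by simp)
  have h2 : MDifferentiableAt (𝓡 n) 𝓘(ℝ, F) g ((extChartAt (𝓡 n) x).symm y) :=
    hg.contMDiffAt.mdifferentiableAt (by simp)
  rw [← mfderiv_eq_fderiv, inChart, mfderiv_comp y h2 h1]
  rfl

theorem inducedMetric_inChart (hg : IsIsometricImmersion h g) {x : M}
    {y : EuclideanSpace ℝ (Fin n)} (hy : y ∈ (extChartAt (𝓡 n) x).target) :
    inducedMetric (inChart n g x) y = metricInChart h x y := by
  ext u v
  rw [inducedMetric_apply, metricInChart_apply, fderiv_inChart_apply hg.contMDiff hy,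
    fderiv_inChart_apply hg.contMDiff hy, hg.inner_eq]

theorem chartDeriv_bijective (x : M) : Function.Bijective (chartDeriv n x) := by
  obtain ⟨e, he⟩ := isInvertible_mfderiv_extChartAt (I := 𝓡 n) (mem_extChartAt_source x)
  rw [chartDeriv, ← he]
  exact e.bijective

theorem fderiv_inChart_chartDeriv (hg : ContMDiff (𝓡 n) 𝓘(ℝ, F) ∞ g) (x : M)
    (X : TangentSpace (𝓡 n) x) :
    fderiv ℝ (inChart n g x) (extChartAt (𝓡 n) x x) (chartDeriv n x X) = differential n g x X := by
  have h1 : MDifferentiableAt (𝓡 n) 𝓘(ℝ, EuclideanSpace ℝ (Fin n)) (extChartAt (𝓡 n) x) x :=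
    mdifferentiableAt_extChartAt (ChartedSpace.mem_chart_source x)
  have h2 : MDifferentiableAt 𝓘(ℝ, EuclideanSpace ℝ (Fin n)) 𝓘(ℝ, F) (inChart n g x)
      (extChartAt (𝓡 n) x x) :=
    ((contDiffAt_inChart hg (mem_extChartAt_target x)).differentiableAt
      (by simp)).mdifferentiableAt
  have h3 : inChart n g x ∘ extChartAt (𝓡 n) x =ᶠ[𝓝 x] g := by
    filter_upwards [extChartAt_source_mem_nhds (I := 𝓡 n) x] with z hz
    exact congrArg g ((extChartAt (𝓡 n) x).left_inv hz)
  have h4 := mfderiv_comp x h2 h1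
  rw [h3.mfderiv_eq, mfderiv_eq_fderiv] at h4
  exact (congrArg (fun T : TangentSpace (𝓡 n) x →L[ℝ] F => T X) h4).symm

theorem differential_injective (hg : IsIsometricImmersion h g) (x : M) :
    Function.Injective (differential n g x) := by
  refine (injective_iff_map_eq_zero _).2 fun X hX => ?_
  by_contra hne
  have h1 := h.pos x X hne
  rw [← hg.inner_eq, hX, inner_zero_left] at h1
  exact h1.false

theorem fderiv_inChart_injective (hg : IsIsometricImmersion h g) (x : M) :
    Function.Injective (fderiv ℝ (inChart n g x) (extChartAt (𝓡 n) x x)) := by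
  intro u v huv
  obtain ⟨X, rfl⟩ := (chartDeriv_bijective x).2 u
  obtain ⟨Y, rfl⟩ := (chartDeriv_bijective x).2 v
  rw [fderiv_inChart_chartDeriv hg.contMDiff, fderiv_inChart_chartDeriv hg.contMDiff] at huv
  rw [differential_injective hg x huv]

variable [FiniteDimensional ℝ F]

theorem secondFundamentalForm_symm (hg : ContMDiff (𝓡 n) 𝓘(ℝ, F) ∞ g) (x : M)
    (X Y : TangentSpace (𝓡 n) x) :
    secondFundamentalForm n g x X Y = secondFundamentalForm n g x Y X :=
  congrArg (normalSpace n g x).orthogonalProjectionOnto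
    (fderiv_fderiv_symm (contDiffAt_inChart hg (mem_extChartAt_target x)) _ _)

/-- The covariant Hessian is normal and differs from the second derivative by a tangent vector, so
it is the normal projection. -/
theorem coe_secondFundamentalForm (hg : IsIsometricImmersion h g) (x : M)
    (X Y : TangentSpace (𝓡 n) x) :
    (secondFundamentalForm n g x X Y : F) =
      covariantHessian (inducedMetric (inChart n g x)) (inChart n g x) (extChartAt (𝓡 n) x x)
        (chartDeriv n x X) (chartDeriv n x Y) := by
  have hf := contDiffAt_inChart hg.contMDiff (mem_extChartAt_target (I := 𝓡 n) x)
  refine Submodule.eq_starProjection_of_mem_of_inner_eq_zero ?_ ?_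
  · rintro _ ⟨Z, rfl⟩
    rw [← fderiv_inChart_chartDeriv hg.contMDiff, real_inner_comm]
    exact inner_covariantHessian_fderiv hf (fderiv_inChart_injective hg x) _ _ _
  · intro w hw
    obtain ⟨Z, hZ⟩ := (chartDeriv_bijective x).2
      (christoffel (inducedMetric (inChart n g x)) (extChartAt (𝓡 n) x x)
        (chartDeriv n x X) (chartDeriv n x Y))
    rw [covariantHessian, ← hZ, fderiv_inChart_chartDeriv hg.contMDiff]
    change inner ℝ (fderiv ℝ (fderiv ℝ (inChart n g x)) _ _ _ - _) w = 0
    rw [sub_sub_cancel]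
    exact hw _ ⟨Z, rfl⟩

/-- The Gauss equation. -/
theorem inner_curvatureInChart (hg : IsIsometricImmersion h g) (x : M)
    (X Y Z T : TangentSpace (𝓡 n) x) :
    inner ℝ (fderiv ℝ (inChart n g x) (extChartAt (𝓡 n) x x) (curvatureInChart h x X Y Z))
        (differential n g x T) =
      inner ℝ (secondFundamentalForm n g x Y Z) (secondFundamentalForm n g x X T)
        - inner ℝ (secondFundamentalForm n g x X Z) (secondFundamentalForm n g x Y T) := by
  have htarget := (isOpen_extChartAt_target (I := 𝓡 n) x).mem_nhds (mem_extChartAt_target x)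
  -- Curvature involves derivatives of the metric, so the two metrics are compared on the open chart
  -- target.
  have hG : metricInChart h x =ᶠ[𝓝 (extChartAt (𝓡 n) x x)] inducedMetric (inChart n g x) := by
    filter_upwards [htarget] with y hy
    exact (inducedMetric_inChart hg hy).symm
  have hf : ∀ᶠ y in 𝓝 (extChartAt (𝓡 n) x x), ContDiffAt ℝ ∞ (inChart n g x) y := by
    filter_upwards [htarget] with y hy
    exact contDiffAt_inChart hg.contMDiff hy
  rw [curvatureInChart, curvature_congr hG, ← fderiv_inChart_chartDeriv hg.contMDiff]
  simp only [Submodule.coe_inner, coe_secondFundamentalForm hg]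
  exact gauss_equation hf (fderiv_inChart_injective hg x) _ _ _ _

theorem inner_secondFundamentalForm_of_mem_nullity (hg : IsIsometricImmersion h g) {x : M}
    {Z : TangentSpace (𝓡 n) x} (hZ : Z ∈ nullity h x) (X Y T : TangentSpace (𝓡 n) x) :
    inner ℝ (secondFundamentalForm n g x X T) (secondFundamentalForm n g x Y Z) =
      inner ℝ (secondFundamentalForm n g x X Z) (secondFundamentalForm n g x Y T) := by
  have hsymm := secondFundamentalForm_symm hg.contMDiff x
  have h1 := inner_curvatureInChart hg x Z T X Y
  rw [hZ T X, map_zero, inner_zero_left, hsymm T X, hsymm Z Y, hsymm Z X, hsymm T Y] at h1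
  exact (sub_eq_zero.1 h1.symm)

theorem finrank_normalSpace_add (hg : IsIsometricImmersion h g) (x : M) :
    n + Module.finrank ℝ (normalSpace n g x) = Module.finrank ℝ F := by
  have h1 := Submodule.finrank_add_finrank_orthogonal (LinearMap.range (differential n g x))
  rw [LinearMap.finrank_range_of_inj (differential_injective hg x)] at h1
  rw [← h1, normalSpace]
  congr 1
  exact (finrank_euclideanSpace_fin (𝕜 := ℝ) (n := n)).symm

end RiemannianGeometry

end

theorem mainTheorem7 (n p : ℕ) {M : Type*} [TopologicalSpace M]
    [ChartedSpace (EuclideanSpace ℝ (Fin n)) M] [IsManifold (𝓡 n) ∞ M]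
    (h : Bundle.ContMDiffRiemannianMetric (𝓡 n) ∞ (EuclideanSpace ℝ (Fin n))
      (fun x : M => TangentSpace (𝓡 n) x))
    (g : M → EuclideanSpace ℝ (Fin (n + p)))
    (hg : RiemannianGeometry.IsIsometricImmersion h g)
    (x : M)
    (hν : (Module.finrank ℝ (RiemannianGeometry.relativeNullity n g x) : ℤ) ≤ n - p - 1) :
    (Module.finrank ℝ (RiemannianGeometry.nullity h x) : ℤ)
        - Module.finrank ℝ (RiemannianGeometry.relativeNullity n g x)
      ≤ Module.finrank ℝ
          (BilinearMap.valueSpan (RiemannianGeometry.restrictedForm h g x)) ∧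
    (Module.finrank ℝ
        (BilinearMap.valueSpan (RiemannianGeometry.restrictedForm h g x)) : ℤ) ≤ p - 1 := by
  have : FiniteDimensional ℝ (TangentSpace (𝓡 n) x) :=
    inferInstanceAs (FiniteDimensional ℝ (EuclideanSpace ℝ (Fin n)))
  have hdim : Module.finrank ℝ (TangentSpace (𝓡 n) x) = n :=
    finrank_euclideanSpace_fin (𝕜 := ℝ) (n := n)
  have hnormal := RiemannianGeometry.finrank_normalSpace_add hg x
  rw [finrank_euclideanSpace_fin] at hnormal
  have hN (Z) (hZ : Z ∈ RiemannianGeometry.nullity h x) :=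
    RiemannianGeometry.inner_secondFundamentalForm_of_mem_nullity hg hZ
  have h1 := BilinearMap.finrank_le_leftNullity_add_valueSpan
    (RiemannianGeometry.secondFundamentalForm_symm hg.contMDiff x) hN
  have h2 := Submodule.finrank_le
    (BilinearMap.valueSpan (RiemannianGeometry.restrictedForm h g x))
  have h3 : Module.finrank ℝ (BilinearMap.valueSpan (RiemannianGeometry.restrictedForm h g x))
      ≠ p := by
    -- The normal space has dimension p, so S(β) would be all of it.
    intro hp
    have h4 := BilinearMap.finrank_le_leftNullity_add_of_valueSpan_eq_top hN
      (Submodule.eq_top_of_finrank_eq (hp.trans (by omega)))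
    rw [RiemannianGeometry.relativeNullity] at hν
    omega
  rw [RiemannianGeometry.relativeNullity] at hν ⊢
  unfold RiemannianGeometry.restrictedForm at h2 h3 ⊢
  omega
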